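/- **Fair ATSs.** An alternating transition system (ATS) $K=\langle\Sigma,W,\hat w,A_1,A_2,P_1,P_2,L,\delta\rangle$ consists of a finite set $\Sigma$ of observations, a finite set $W$ of states with initial state $\hat w$, finite action sets $A_1,A_2$ of Agents 1 and 2, maps $P_i:W\to 2^{A_i}\setminus\{\emptyset\}$ giving the available actions, a labeling $L:W\to\Sigma$, and a transition function $\delta:W\times A_1\times A_2\to W$. A $w$-run is an infinite sequence of states that starts in $w$ and follows $\delta$ under available actions. A fair ATS $\mathcal K=\langle K,F\rangle$ is an ATS with a set $F\subseteq W$; a run is fair if it visits $F$ infinitely often. Let $\mathcal K=\langle K,F\rangle$ and $\mathcal K'=\langle K',F'\rangle$ be two fair ATSs over the same $\Sigma$, the components of $K'$ being primed. **Simulations.** Consider strategies (always choosing actions available at the current state) $\tau:(W\times W')^+\to A_1$, $\ \tau':(W\times W')^+\times A_1\to A_1'$, $\ \xi':(W\times W')^+\times A_1\times A_1'\to A_2'$, $\ \xi:(W\times W')^+\times A_1\times A_1'\times A_2'\to A_2$. From $(w,w')$ they produce runs $\rho=\rho(w,w',\tau,\tau',\xi,\xi')$ of $K$ and $\rho'=\rho'(w,w',\tau,\tau',\xi,\xi')$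 of $K'$: in each round, given the word $h$ of state pairs so far, ending in $(u,u')$, put $a=\tau(h)$, $a'=\tau'(h,a)$, $b'=\xi'(h,a,a')$, $b=\xi(h,a,a',b')$, and move to $(\delta(u,a,b),\delta'(u',a',b'))$. A relation $S\subseteq W\times W'$ is a *weak fair alternating simulation* if for all $(w,w')\in W\times W'$: (1) if $(w,w')\in S$ then $L(w)=L'(w')$; and (2) $\exists\tau'\,\forall\tau\,\exists\xi\,\forall\xi'$: if $(w,w')\in S$ and $\rho$ is a fair $w$-run of $\mathcal K$, then $\rho'$ is a fair $w'$-run of $\mathcal K'$ and $(\rho_i,\rho'_i)\in S$ for all $i\ge 0$. It is a *strong fair alternating simulation* if the same holds with the quantifiers $\exists\tau'\,\exists\xi\,\forall\tau\,\forall\xi'$ in (2). Let $\preceq^{\mathsf{weak}}$ and $\preceq^{\mathsf{strong}}$ denote the maximum (with respect to inclusion) weak, respectively strong, fair alternating simulation. **Game.** Let $\mathsf{Succ}(w,a)=\{\delta(w,a,b)\mid b\in P_2(w)\}$ and $\mathsf{Succ}(K)=\{\mathsf{Succ}(w,a)\mid w\in W,\ a\in P_1(w)\}$, and similarly for $K'$.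 The player 1 vertices are the pairs $\langle w,w'\rangle$ with $w\in W$, $w'\in W'$, $L(w)=L'(w')$, the pairs $\langle T,T'\rangle\in\mathsf{Succ}(K)\times\mathsf{Succ}(K')$, and a vertex $\bot$. The player 2 vertices are the triples $\langle T,w',\bowtie\rangle\in\mathsf{Succ}(K)\times W'\times\{\#,\$\}$. The edges are: - $\langle w,w'\rangle\to\langle\mathsf{Succ}(w,a),w',\#\rangle$ for $a\in P_1(w)$; - $\langle T,w',\#\rangle\to\langle T,\mathsf{Succ}(w',a')\rangle$ for $a'\in P_1'(w')$; - $\langle T,T'\rangle\to\langle T,r',\$\rangle$ for $r'\in T'$; - $\langle T,r',\$\rangle\to\langle r,r'\rangle$ for $r\in T$ with $L(r)=L'(r')$; - $\langle T,r',\$\rangle\to\bot$ if $L(r)\ne L'(r')$ for all $r\in T$; - $\bot\to\bot$. The owner of the current vertex chooses the next edge, by a strategy that may depend on the whole history. The priority is $0$ for $\langle w,w'\rangle$ with $w'\in F'$; it is $1$ for $\langle w,w'\rangle$ with $w\in F$, $w'\notin F'$, and for $\bot$; it is $2$ for all other vertices. Player 2 wins a play if the least priority occurring infinitely often is even. Let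 $\mathsf{Win}_2$ be the set of $(w,w')$ with $L(w)=L'(w')$ such that player 2 has a strategy that wins from $\langle w,w'\rangle$ against every strategy of player 1. **Proposition.** Assume that from every state $w\in W$ Agent 1 has a strategy in $K$ (a choice of an available action depending on the states visited so far) such that every $w$-run consistent with it, whatever available actions Agent 2 takes, is fair. Then the maximum weak and the maximum strong fair alternating simulations of $\mathcal K$ by $\mathcal K'$ exist, and $$\mathsf{Win}_2=\preceq^{\mathsf{weak}}=\preceq^{\mathsf{strong}}.$$ -/

import Mathlib

/-- The set of elements that occur infinitely often in an infinite sequence. -/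
def infOften {X : Type*} (ω : ℕ → X) : Set X :=
  {x | ∃ᶠ k in Filter.atTop, ω k = x}

/-! ### Two-player game graphs -/

/-- A two-player game graph: a directed graph without dead ends, with the vertices partitioned
into those of player 1 (the set `V₁`) and those of player 2 (its complement). -/
structure GameGraph (V : Type*) where
  E : V → V → Prop
  V₁ : Set V
  exists_succ : ∀ v, ∃ u, E v u

namespace GameGraph

variable {V : Type*} (G : GameGraph V)

/-- The vertices of player 2. -/
def V₂ : Set V := G.V₁ᶜ

/-- A strategy of player 1: given the word of the vertices visited before and the current
vertex, which belongs to player 1, it chooses an out-neighbour of the current vertex. -/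
def Strategy₁ : Type _ := List V → (v : G.V₁) → {u : V // G.E v u}

/-- A strategy of player 2. -/
def Strategy₂ : Type _ := List V → (v : G.V₂) → {u : V // G.E v u}

variable {G}

open Classical in
/-- The next vertex, after the history `h` (the current vertex not included), from `v`. -/
noncomputable def next (α : G.Strategy₁) (β : G.Strategy₂) (h : List V) (v : V) : V :=
  if hv : v ∈ G.V₁ then (α h ⟨v, hv⟩).1 else (β h ⟨v, hv⟩).1

/-- The vertices visited strictly before time `n`, and the vertex at time `n`. -/
noncomputable def playAux (v : V) (α : G.Strategy₁) (β : G.Strategy₂) : ℕ → List V × V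
  | 0 => ([], v)
  | n + 1 =>
    let s := playAux v α β n
    (s.1 ++ [s.2], next α β s.1 s.2)

/-- The unique play from `v` in which the players follow `α` and `β`. -/
noncomputable def play (v : V) (α : G.Strategy₁) (β : G.Strategy₂) (n : ℕ) : V :=
  (playAux v α β n).2

variable (G)

/-- The winning set of player 2 for an objective `Ψ`. -/
def winningSet₂ (Ψ : Set (ℕ → V)) : Set V :=
  {v | ∃ β : G.Strategy₂, ∀ α : G.Strategy₁, play v α β ∈ Ψ}

end GameGraph

/-- The parity objective for a priority function with the priorities 0, 1, 2: the least
priority visited infinitely often is even. -/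
def ParityObjective {V : Type*} (p : V → Fin 3) : Set (ℕ → V) :=
  {ω | (infOften ω ∩ p ⁻¹' {0}).Nonempty ∨ infOften ω ∩ p ⁻¹' {1} = ∅}

/-! ### Fair alternating transition systems -/

/-- A labeled alternating transition system with observations `Obs`, states `W`, and actions
`A₁`, `A₂` of the two agents. -/
structure ATS (Obs W A₁ A₂ : Type*) where
  init : W
  P₁ : W → Set A₁
  P₂ : W → Set A₂
  P₁_nonempty : ∀ w, (P₁ w).Nonempty
  P₂_nonempty : ∀ w, (P₂ w).Nonempty
  L : W → Obs
  δ : W → A₁ → A₂ → W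

/-- An alternating transition system together with a set `F` of Büchi states. -/
structure FairATS (Obs W A₁ A₂ : Type*) extends ATS Obs W A₁ A₂ where
  F : Set W

namespace ATS

variable {Obs W A₁ A₂ : Type*} (K : ATS Obs W A₁ A₂)

/-- `ρ` is a `w`-run: it starts in `w`, and every step is made by available actions. -/
def IsRun (w : W) (ρ : ℕ → W) : Prop :=
  ρ 0 = w ∧ ∀ n, ∃ a ∈ K.P₁ (ρ n), ∃ b ∈ K.P₂ (ρ n), ρ (n + 1) = K.δ (ρ n) a b

/-- The set of possible successors of `w` under the action `a` of Agent 1. -/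
def Succ (w : W) (a : A₁) : Set W := {r | ∃ b ∈ K.P₂ w, r = K.δ w a b}

/-- The set of all successor sets of available actions of Agent 1. -/
def SuccSets : Set (Set W) := {T | ∃ w, ∃ a ∈ K.P₁ w, T = K.Succ w a}

theorem succ_mem_succSets {w : W} {a : A₁} (ha : a ∈ K.P₁ w) : K.Succ w a ∈ K.SuccSets :=
  ⟨w, a, ha, rfl⟩

theorem nonempty_of_mem_succSets {T : Set W} (hT : T ∈ K.SuccSets) : T.Nonempty := by
  obtain ⟨w, a, -, rfl⟩ := hT
  obtain ⟨b, hb⟩ := K.P₂_nonempty w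
  exact ⟨_, b, hb, rfl⟩

end ATS

namespace FairATS

variable {Obs W A₁ A₂ : Type*} (K : FairATS Obs W A₁ A₂)

/-- `ρ` is a fair `w`-run: a `w`-run that visits `F` infinitely often. -/
def IsFairRun (w : W) (ρ : ℕ → W) : Prop :=
  K.IsRun w ρ ∧ (infOften ρ ∩ K.F).Nonempty

/-- Agent 1 has a strategy (a choice of an available action, given the states visited before
and the current state) such that every `w`-run consistent with it is fair, whatever
available actions Agent 2 takes. -/
def CanEnsureFairness (w : W) : Prop :=
  ∃ σ : List W → (u : W) → {a : A₁ // a ∈ K.P₁ u},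
    ∀ ρ : ℕ → W, ρ 0 = w →
      (∀ n, ∃ b ∈ K.P₂ (ρ n),
        ρ (n + 1) = K.δ (ρ n) (σ ((List.range n).map ρ) (ρ n)) b) →
      K.IsFairRun w ρ

end FairATS

/-! ### Fair alternating simulation

In all strategies below, the nonempty word of state pairs seen so far is given as the list of
the earlier pairs and the current pair; the chosen action is available at the current state. -/

section Simulation

variable {Obs W W' A₁ A₂ A₁' A₂' : Type*}
variable (K : FairATS Obs W A₁ A₂) (K' : FairATS Obs W' A₁' A₂')

/-- Strategies `τ` of Agent 1 in `K`. -/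
def Tau : Type _ :=
  List (W × W') → (s : W × W') → {a : A₁ // a ∈ K.P₁ s.1}

/-- Strategies `τ'` of Agent 1 in `K'`, which also see the action of Agent 1 in `K`. -/
def Tau' : Type _ :=
  List (W × W') → (s : W × W') → A₁ → {a' : A₁' // a' ∈ K'.P₁ s.2}

/-- Strategies `ξ'` of Agent 2 in `K'`, which also see the actions of both Agents 1. -/
def Xi' : Type _ :=
  List (W × W') → (s : W × W') → A₁ → A₁' → {b' : A₂' // b' ∈ K'.P₂ s.2}

/-- Strategies `ξ` of Agent 2 in `K`, which also see the actions of both Agents 1 and of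
Agent 2 in `K'`. -/
def Xi : Type _ :=
  List (W × W') → (s : W × W') → A₁ → A₁' → A₂' → {b : A₂ // b ∈ K.P₂ s.1}

variable {K K'}

/-- The next state pair: the actions are chosen in the order `a`, `a'`, `b'`, `b`. -/
def simNext (τ : Tau (W' := W') K) (τ' : Tau' (W := W) (A₁ := A₁) K')
    (ξ : Xi (W' := W') (A₁' := A₁') (A₂' := A₂') K) (ξ' : Xi' (W := W) (A₁ := A₁) K')
    (h : List (W × W')) (s : W × W') : W × W' :=
  let a := (τ h s).1
  let a' := (τ' h s a).1
  let b' := (ξ' h s a a').1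
  let b := (ξ h s a a' b').1
  (K.δ s.1 a b, K'.δ s.2 a' b')

/-- The state pairs before time `n`, and the state pair at time `n`. -/
def simAux (w : W) (w' : W') (τ : Tau (W' := W') K) (τ' : Tau' (W := W) (A₁ := A₁) K')
    (ξ : Xi (W' := W') (A₁' := A₁') (A₂' := A₂') K) (ξ' : Xi' (W := W) (A₁ := A₁) K') :
    ℕ → List (W × W') × (W × W')
  | 0 => ([], (w, w'))
  | n + 1 =>
    let x := simAux w w' τ τ' ξ ξ' n
    (x.1 ++ [x.2], simNext τ τ' ξ ξ' x.1 x.2)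

/-- The run `ρ(w, w', τ, τ', ξ, ξ')` that emerges in `K`. -/
def simRun (w : W) (w' : W') (τ : Tau (W' := W') K) (τ' : Tau' (W := W) (A₁ := A₁) K')
    (ξ : Xi (W' := W') (A₁' := A₁') (A₂' := A₂') K) (ξ' : Xi' (W := W) (A₁ := A₁) K')
    (n : ℕ) : W :=
  (simAux w w' τ τ' ξ ξ' n).2.1

/-- The run `ρ'(w, w', τ, τ', ξ, ξ')` that emerges in `K'`. -/
def simRun' (w : W) (w' : W') (τ : Tau (W' := W') K) (τ' : Tau' (W := W) (A₁ := A₁) K')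
    (ξ : Xi (W' := W') (A₁' := A₁') (A₂' := A₂') K) (ξ' : Xi' (W := W) (A₁ := A₁) K')
    (n : ℕ) : W' :=
  (simAux w w' τ τ' ξ ξ' n).2.2

/-- `ρ'` `S`-matches `ρ`. -/
def Matches (S : Set (W × W')) (ρ : ℕ → W) (ρ' : ℕ → W') : Prop :=
  ∀ n, (ρ n, ρ' n) ∈ S

variable (K K')

/-- `S` is a weak fair alternating simulation of `K` by `K'`. -/
def IsWeakFairAltSim (S : Set (W × W')) : Prop :=
  ∀ (w : W) (w' : W'),
    ((w, w') ∈ S → K.L w = K'.L w') ∧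
    ∃ τ' : Tau' (W := W) (A₁ := A₁) K', ∀ τ : Tau (W' := W') K,
      ∃ ξ : Xi (W' := W') (A₁' := A₁') (A₂' := A₂') K,
      ∀ ξ' : Xi' (W := W) (A₁ := A₁) K',
        (w, w') ∈ S → K.IsFairRun w (simRun w w' τ τ' ξ ξ') →
          K'.IsFairRun w' (simRun' w w' τ τ' ξ ξ') ∧
          Matches S (simRun w w' τ τ' ξ ξ') (simRun' w w' τ τ' ξ ξ')

/-- `S` is a strong fair alternating simulation of `K` by `K'`. -/
def IsStrongFairAltSim (S : Set (W × W')) : Prop :=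
  ∀ (w : W) (w' : W'),
    ((w, w') ∈ S → K.L w = K'.L w') ∧
    ∃ (τ' : Tau' (W := W) (A₁ := A₁) K')
      (ξ : Xi (W' := W') (A₁' := A₁') (A₂' := A₂') K),
      ∀ (τ : Tau (W' := W') K) (ξ' : Xi' (W := W) (A₁ := A₁) K'),
        (w, w') ∈ S → K.IsFairRun w (simRun w w' τ τ' ξ ξ') →
          K'.IsFairRun w' (simRun' w w' τ τ' ξ ξ') ∧
          Matches S (simRun w w' τ τ' ξ ξ') (simRun' w w' τ τ' ξ ξ')

/-! ### The game -/

/-- The vertices of the game: `pair w w'` for states with equal labels, pairs of successor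
sets, the losing sink `frown`, and the vertices `⟨T, w', #⟩` (`hash`) and `⟨T, w', $⟩`
(`dollar`). -/
inductive SimVertex where
  | pair (w : W) (w' : W') (h : K.L w = K'.L w')
  | succPair (T : K.SuccSets) (T' : K'.SuccSets)
  | frown
  | hash (T : K.SuccSets) (w' : W')
  | dollar (T : K.SuccSets) (w' : W')

/-- The edges of the game. -/
inductive SimEdge : SimVertex K K' → SimVertex K K' → Prop
  | e₁ (w : W) (w' : W') (h : K.L w = K'.L w') (a : A₁) (ha : a ∈ K.P₁ w) :
      SimEdge (.pair w w' h) (.hash ⟨K.Succ w a, K.succ_mem_succSets ha⟩ w')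
  | e₂ (T : K.SuccSets) (w' : W') (a' : A₁') (ha' : a' ∈ K'.P₁ w') :
      SimEdge (.hash T w') (.succPair T ⟨K'.Succ w' a', K'.succ_mem_succSets ha'⟩)
  | e₃ (T : K.SuccSets) (T' : K'.SuccSets) (r' : W') (hr' : r' ∈ T'.1) :
      SimEdge (.succPair T T') (.dollar T r')
  | e₄₁ (T : K.SuccSets) (r : W) (r' : W') (hr : r ∈ T.1) (h : K.L r = K'.L r') :
      SimEdge (.dollar T r') (.pair r r' h)
  | e₄₂ (T : K.SuccSets) (r' : W') (h : ∀ r ∈ T.1, K.L r ≠ K'.L r') :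
      SimEdge (.dollar T r') .frown
  | e₅ : SimEdge .frown .frown

/-- The vertices of player 1. -/
def simV₁ : Set (SimVertex K K') :=
  {v | match v with
    | .pair _ _ _ => True
    | .succPair _ _ => True
    | .frown => True
    | .hash _ _ => False
    | .dollar _ _ => False}

/-- The game graph constructed from two fair alternating transition systems. -/
def simGame : GameGraph (SimVertex K K') where
  E := SimEdge K K'
  V₁ := simV₁ K K'
  exists_succ := by
    rintro (⟨w, w', h⟩ | ⟨T, T'⟩ | _ | ⟨T, w'⟩ | ⟨T, w'⟩)
    · obtain ⟨a, ha⟩ := K.P₁_nonempty w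
      exact ⟨_, .e₁ w w' h a ha⟩
    · obtain ⟨r', hr'⟩ := K'.nonempty_of_mem_succSets T'.2
      exact ⟨_, .e₃ T T' r' hr'⟩
    · exact ⟨_, .e₅⟩
    · obtain ⟨a', ha'⟩ := K'.P₁_nonempty w'
      exact ⟨_, .e₂ T w' a' ha'⟩
    · by_cases h : ∃ r ∈ T.1, K.L r = K'.L w'
      · obtain ⟨r, hr, hL⟩ := h
        exact ⟨_, .e₄₁ T r w' hr hL⟩
      · exact ⟨_, .e₄₂ T w' fun r hr hL => h ⟨r, hr, hL⟩⟩

open Classical in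
/-- The priority function of the game. -/
noncomputable def simPriority : SimVertex K K' → Fin 3
  | .pair w w' _ => if w' ∈ K'.F then 0 else if w ∈ K.F then 1 else 2
  | .frown => 1
  | .succPair _ _ => 2
  | .hash _ _ => 2
  | .dollar _ _ => 2

/-- The state pairs that, as vertices of the game, are won by player 2 for the parity
objective. -/
def simWin₂ : Set (W × W') :=
  {s | ∃ h : K.L s.1 = K'.L s.2,
    SimVertex.pair s.1 s.2 h ∈
      (simGame K K').winningSet₂ (ParityObjective (simPriority K K'))}

end Simulation

/-! The parity game is positionally determined. Player 2 wins exactly from νX. μY. νT. `parityStep X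
Y T`, and stages of the fixed-point iterations supply ranks: inside, a rank that drops at priority 1
and can rise only at priority 0; outside, ranks `n`, `m` that player 1 drives down so that priority
0 dies out and priority 1 recurs.

The four edges of a round are the choices a, a', b', b in the order used by the strategies, so the
ranks descend to state pairs. On `simWin₂`, decreasing the rank yields memoryless τ' and ξ, hence a
strong simulation. Conversely, from a pair outside `simWin₂`, memoryless choices of a and b' make ρ
fair and ρ' unfair as long as labels agree. Should they disagree, the game says nothing; there Agent
1 switches to a strategy ensuring fairness, so that ρ is fair and a simulation would have to match
the mismatched pair.

This refutes even weak simulations, since τ and ξ' are fixed without knowing τ' and ξ. As strong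
implies weak, `simWin₂` is the greatest of both kinds. -/

/-! ### Ranks along sequences of sets -/

section Rank

variable {V : Type*}

/-- The index at which `v` leaves the sequence of sets `A`. -/
noncomputable def exitRank (A : ℕ → Set V) (v : V) : ℕ := sInf {k | v ∉ A (k + 1)}

theorem exitRank_lt_of_notMem {A : ℕ → Set V} (hA : A 0 = Set.univ) {v : V} {n : ℕ}
    (h : v ∉ A n) : exitRank A v < n := by
  cases n with
  | zero => exact absurd (hA ▸ Set.mem_univ v) h
  | succ k => exact Nat.lt_succ_of_le (Nat.sInf_le h)

theorem notMem_exitRank_succ {A : ℕ → Set V} (hA : A 0 = Set.univ) {v : V} {n : ℕ}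
    (h : v ∉ A n) : v ∉ A (exitRank A v + 1) := by
  cases n with
  | zero => exact absurd (hA ▸ Set.mem_univ v) h
  | succ k => exact Nat.sInf_mem (s := {k | v ∉ A (k + 1)}) ⟨k, h⟩

end Rank

/-! ### Reaching extremal fixed points by finite iteration -/

section Iterate

variable {α : Type*} [CompleteLattice α] (g : α →o α)

theorem OrderHom.gfp_le_iterate (n : ℕ) : g.gfp ≤ g^[n] ⊤ := by
  induction n with
  | zero => exact le_top
  | succ k ih =>
    rw [Function.iterate_succ_apply', ← g.map_gfp]
    exact g.mono ih

theorem OrderHom.iterate_le_lfp (n : ℕ) : g^[n] ⊥ ≤ g.lfp := by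
  induction n with
  | zero => exact bot_le
  | succ k ih =>
    rw [Function.iterate_succ_apply', ← g.map_lfp]
    exact g.mono ih

theorem OrderHom.exists_iterate_eq_lfp [Finite α] : ∃ n, g^[n] ⊥ = g.lfp := by
  obtain ⟨n, hn⟩ := WellFoundedGT.monotone_chain_condition
    ⟨fun n => g^[n] ⊥, g.mono.monotone_iterate_of_le_map bot_le⟩
  refine ⟨n, le_antisymm (g.iterate_le_lfp n) (g.lfp_le ?_)⟩
  have := hn (n + 1) (Nat.le_succ n)
  simp only [OrderHom.coe_mk, Function.iterate_succ_apply'] at this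
  exact this.ge

theorem OrderHom.exists_iterate_eq_gfp [Finite α] : ∃ n, g^[n] ⊤ = g.gfp := by
  obtain ⟨n, hn⟩ := (OrderHom.dual g).exists_iterate_eq_lfp
  exact ⟨n, hn⟩

end Iterate

/-! ### Priority sequences -/

/-- Once 0 has ceased, `r` is nonincreasing, hence eventually constant, which excludes any later 1.
-/
theorem frequently_zero_or_eventually_ne_one {q : ℕ → Fin 3} {r : ℕ → ℕ}
    (h₁ : ∀ k, q k = 1 → r (k + 1) < r k) (h₂ : ∀ k, q k = 2 → r (k + 1) ≤ r k) :
    (∃ᶠ k in Filter.atTop, q k = 0) ∨ ∀ᶠ k in Filter.atTop, q k ≠ 1 := by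
  by_contra! hcon
  obtain ⟨h0, h1⟩ := hcon
  rw [Filter.eventually_atTop] at h0
  obtain ⟨N, hN⟩ := h0
  have hanti : Antitone fun k => r (N + k) := antitone_nat_of_succ_le fun k => by
    have h := hN (N + k) (Nat.le_add_right _ _)
    have : q (N + k) = 1 ∨ q (N + k) = 2 := by grind
    rcases this with h | h
    · exact (h₁ _ h).le
    · exact h₂ _ h
  obtain ⟨M, hM⟩ := WellFoundedLT.antitone_chain_condition hanti
  rw [Filter.frequently_atTop] at h1
  obtain ⟨k, hk, hk1⟩ := h1 (N + M)
  obtain ⟨j, rfl⟩ := Nat.exists_eq_add_of_le hk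
  have e1 := hM (M + j) (Nat.le_add_right _ _)
  have e2 := hM (M + j + 1) (by omega)
  have e3 := h₁ _ hk1
  simp only [← add_assoc] at e1 e2
  omega

/-- When `n` has stabilised, 0 is impossible and every 2 lowers `m`. Only a 1 can let `m` rise
again, so the 1s cannot stop. -/
theorem eventually_ne_zero_and_frequently_one {q : ℕ → Fin 3} {n m : ℕ → ℕ}
    (h : ∀ k, n (k + 1) ≤ n k) (h₀ : ∀ k, q k = 0 → n (k + 1) < n k)
    (h₂ : ∀ k, q k = 2 → n (k + 1) < n k ∨ m (k + 1) < m k) :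
    (∀ᶠ k in Filter.atTop, q k ≠ 0) ∧ ∃ᶠ k in Filter.atTop, q k = 1 := by
  obtain ⟨N, hN⟩ := WellFoundedLT.antitone_chain_condition (antitone_nat_of_succ_le h)
  have hconst : ∀ k, N ≤ k → n (k + 1) = n k := fun k hk => by
    rw [← hN k hk, ← hN (k + 1) (by omega)]
  have hne : ∀ k, N ≤ k → q k ≠ 0 := fun k hk h0 => by
    have := h₀ k h0
    have := hconst k hk
    omega
  refine ⟨Filter.eventually_atTop.2 ⟨N, hne⟩, Filter.frequently_atTop.2 fun M => ?_⟩
  by_contra! hcon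
  have hdec : ∀ j, m (N + M + j) + j ≤ m (N + M) := fun j => by
    induction j with
    | zero => rfl
    | succ j ih =>
      have ha := hne (N + M + j) (by omega)
      have hb := hcon (N + M + j) (by omega)
      have hc : q (N + M + j) = 2 := by grind
      have hd := hconst (N + M + j) (by omega)
      have he := h₂ _ hc
      simp only [← add_assoc] at *
      omega
  -- One step more than the value of `m` allows.
  have := hdec (m (N + M) + 1)
  omega

theorem infOften_inter_nonempty_iff {X : Type*} [Finite X] (ω : ℕ → X) (B : Set X) :
    (infOften ω ∩ B).Nonempty ↔ ∃ᶠ k in Filter.atTop, ω k ∈ B := by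
  constructor
  · rintro ⟨x, hx, hB⟩
    exact Filter.Frequently.mono hx fun k hk => hk ▸ hB
  · intro h
    have : ∃ᶠ k in Filter.atTop, ∃ x : X, ω k = x ∧ x ∈ B := by simpa using h
    obtain ⟨x, hx⟩ := Filter.frequently_exists.1 this
    exact ⟨x, hx.mono fun _ h => h.1, (hx.exists.choose_spec).2⟩

theorem mem_parityObjective_iff {V : Type*} [Finite V] (p : V → Fin 3) (ω : ℕ → V) :
    ω ∈ ParityObjective p ↔
      (∃ᶠ k in Filter.atTop, p (ω k) = 0) ∨ ∀ᶠ k in Filter.atTop, p (ω k) ≠ 1 := by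
  rw [ParityObjective, Set.mem_ofPred_eq, ← Set.not_nonempty_iff_eq_empty,
    infOften_inter_nonempty_iff, infOften_inter_nonempty_iff, Filter.not_frequently]
  rfl

/-! ### Positional determinacy of parity games with three priorities -/

namespace GameGraph

variable {V : Type*} (G : GameGraph V)

/-- The vertices from which player 2 can force the next vertex into `X`. -/
def cpre (X : Set V) : Set V :=
  {v | (v ∈ G.V₁ → ∀ u, G.E v u → u ∈ X) ∧ (v ∉ G.V₁ → ∃ u, G.E v u ∧ u ∈ X)}

variable {G} in
theorem cpre_mono {X Y : Set V} (h : X ⊆ Y) : G.cpre X ⊆ G.cpre Y := fun _ hv =>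
  ⟨fun h₁ u hu => h (hv.1 h₁ u hu), fun h₂ => (hv.2 h₂).imp fun _ hu => ⟨hu.1, h hu.2⟩⟩

variable {G} in
theorem notMem_cpre_iff {X : Set V} {v : V} :
    v ∉ G.cpre X ↔
      (v ∈ G.V₁ → ∃ u, G.E v u ∧ u ∉ X) ∧ (v ∉ G.V₁ → ∀ u, G.E v u → u ∉ X) := by
  by_cases h : v ∈ G.V₁ <;> simp [cpre, h]

variable (p : V → Fin 3)

/-- Player 2 forces the next vertex into the set that belongs to the current priority. -/
def parityStep (X Y T : Set V) : Set V :=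
  {v | (p v = 0 → v ∈ G.cpre X) ∧ (p v = 1 → v ∈ G.cpre Y) ∧ (p v = 2 → v ∈ G.cpre T)}

variable {G p} in
theorem parityStep_mono {X X' Y Y' T T' : Set V} (hX : X ⊆ X') (hY : Y ⊆ Y') (hT : T ⊆ T') :
    G.parityStep p X Y T ⊆ G.parityStep p X' Y' T' := fun _ hv =>
  ⟨fun h => cpre_mono hX (hv.1 h), fun h => cpre_mono hY (hv.2.1 h),
    fun h => cpre_mono hT (hv.2.2 h)⟩

/-- `parityStep` as a monotone function of the set for priority 2. -/
def parityHom₂ (X Y : Set V) : Set V →o Set V :=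
  ⟨G.parityStep p X Y, fun _ _ h => parityStep_mono subset_rfl subset_rfl h⟩

/-- The greatest fixed point of `parityHom₂`, as a function of the set for priority 1. -/
def parityHom₁ (X : Set V) : Set V →o Set V :=
  ⟨fun Y => (G.parityHom₂ p X Y).gfp, fun _ _ h => OrderHom.gfp.mono fun _ =>
    parityStep_mono subset_rfl h subset_rfl⟩

/-- The least fixed point of `parityHom₁`, as a function of the set for priority 0. -/
def parityHom₀ : Set V →o Set V :=
  ⟨fun X => (G.parityHom₁ p X).lfp, fun _ _ h => OrderHom.lfp.mono fun _ =>
    OrderHom.gfp.mono fun _ => parityStep_mono h subset_rfl subset_rfl⟩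

/-- The fixed-point characterization of the set of vertices won by player 2. -/
def parityFix : Set V := (G.parityHom₀ p).gfp

theorem exists_rank_of_mem_parityFix [Finite V] :
    ∃ r : V → ℕ, ∀ v ∈ G.parityFix p,
      v ∈ G.cpre {u | u ∈ G.parityFix p ∧ (p v = 1 → r u < r v) ∧ (p v = 2 → r u ≤ r v)} := by
  set Z := G.parityFix p with hZ
  set g := G.parityHom₁ p Z with hg
  have hZg : g.lfp = Z := (G.parityHom₀ p).map_gfp
  -- Complements turn entry into the increasing stages into exit: the rank of `v` is the least `k`
  -- with `v ∈ g^[k + 1] ⊥`.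
  set A : ℕ → Set V := fun n => (g^[n] ⊥)ᶜ with hA
  have hA0 : A 0 = Set.univ := by simp [hA]
  have hsub : ∀ n u, u ∉ A n → u ∈ Z := fun n u hu => by
    rw [← hZg]
    exact g.iterate_le_lfp n (by simpa [hA] using hu)
  refine ⟨exitRank A, fun v hv => ?_⟩
  obtain ⟨N, hN⟩ := g.exists_iterate_eq_lfp
  have hvN : v ∉ A N := by
    rw [← hZg, ← hN] at hv
    simpa [hA] using hv
  have hout := notMem_exitRank_succ hA0 hvN
  set k := exitRank A v with hk
  have hmem : v ∈ (G.parityHom₂ p Z (g^[k] ⊥)).gfp := by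
    simp only [hA, Function.iterate_succ_apply', Set.mem_compl_iff, not_not] at hout
    exact hout
  -- The inner greatest fixed point is the stage `g^[k + 1] ⊥` itself; unfold it once.
  have hstep : v ∈ G.parityStep p Z (g^[k] ⊥) (g^[k + 1] ⊥) := by
    rw [← OrderHom.map_gfp] at hmem
    rw [Function.iterate_succ_apply']
    exact hmem
  have h3 : p v = 0 ∨ p v = 1 ∨ p v = 2 := by grind
  rcases h3 with h | h | h
  · refine cpre_mono (fun u hu => ?_) (hstep.1 h)
    exact ⟨hu, by simp [h], by simp [h]⟩
  · refine cpre_mono (fun u hu => ?_) (hstep.2.1 h)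
    have hu' : u ∉ A k := by simpa [hA] using hu
    exact ⟨hsub _ _ hu', fun _ => exitRank_lt_of_notMem hA0 hu', by simp [h]⟩
  · refine cpre_mono (fun u hu => ?_) (hstep.2.2 h)
    have hu' : u ∉ A (k + 1) := by rw [hA]; exact not_not.2 hu
    exact ⟨hsub _ _ hu', by simp [h], fun _ => Nat.le_of_lt_succ (exitRank_lt_of_notMem hA0 hu')⟩

theorem exists_rank_of_notMem_parityFix [Finite V] :
    ∃ n m : V → ℕ, ∀ v ∉ G.parityFix p,
      v ∉ G.cpre {u | ¬ (u ∉ G.parityFix p ∧ n u ≤ n v ∧ (p v = 0 → n u < n v) ∧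
        (p v = 2 → n u < n v ∨ m u < m v))} := by
  set Z := G.parityFix p with hZ
  set g := G.parityHom₀ p with hg
  set A : ℕ → Set V := fun n => g^[n] ⊤ with hA
  have hA0 : A 0 = Set.univ := rfl
  have hsub : ∀ n u, u ∉ A n → u ∉ Z := fun n u hu h => hu (g.gfp_le_iterate n h)
  -- The outer stage `A (n + 1)`, being a fixed point of `parityHom₁ p (A n)`, is itself a greatest
  -- fixed point, which `B n` approximates from above.
  set B : ℕ → ℕ → Set V := fun n k => (G.parityHom₂ p (A n) (A (n + 1)))^[k] ⊤ with hB
  have hB0 : ∀ n, B n 0 = Set.univ := fun n => rfl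
  have hfix : ∀ n, (G.parityHom₂ p (A n) (A (n + 1))).gfp = A (n + 1) := fun n => by
    have : A (n + 1) = (G.parityHom₁ p (A n)).lfp := by
      simp only [hA, Function.iterate_succ_apply']
      rfl
    rw [this]
    exact (G.parityHom₁ p (A n)).map_lfp
  have hBA : ∀ n k, A (n + 1) ⊆ B n k := fun n k => by
    have := (G.parityHom₂ p (A n) (A (n + 1))).gfp_le_iterate k
    rwa [hfix] at this
  refine ⟨exitRank A, fun v => exitRank (B (exitRank A v)) v, fun v hv hcon => ?_⟩
  obtain ⟨N, hN⟩ := g.exists_iterate_eq_gfp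
  have hout := notMem_exitRank_succ (n := N) hA0 (v := v) (by rw [hA]; simp only [hN]; exact hv)
  set k := exitRank A v with hk
  obtain ⟨M, hM⟩ := (G.parityHom₂ p (A k) (A (k + 1))).exists_iterate_eq_gfp
  have hout' := notMem_exitRank_succ (n := M) (hB0 k) (v := v) (by
    rw [hB]; simp only [hM, hfix]; exact hout)
  set j := exitRank (B k) v with hj
  -- If player 2 could force a violation of the rank conditions, monotonicity of `cpre` would put
  -- `v` in `B k (j + 1)`.
  apply hout'
  simp only [hB, Function.iterate_succ_apply']
  refine ⟨fun h => ?_, fun h => ?_, fun h => ?_⟩ <;>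
  refine cpre_mono (fun u hu => ?_) hcon <;> by_contra hu' <;> apply hu
  · have hlt := exitRank_lt_of_notMem hA0 hu'
    exact ⟨hsub _ _ hu', hlt.le, fun _ => hlt, by simp [h]⟩
  · have hlt := exitRank_lt_of_notMem hA0 hu'
    exact ⟨hsub _ _ hu', Nat.le_of_lt_succ hlt, by simp [h], by simp [h]⟩
  · have huA : u ∉ A (k + 1) := fun hmem => hu' (hBA k j hmem)
    have hle := Nat.le_of_lt_succ (exitRank_lt_of_notMem hA0 huA)
    refine ⟨hsub _ _ huA, hle, by simp [h], fun _ => ?_⟩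
    rcases hle.lt_or_eq with hlt | heq
    · exact Or.inl hlt
    -- The rank `m` of `u` is taken in the sequence `B (n u)`, comparable with that of `v` only
    -- because `n u = n v`.
    · right
      simp only [heq]
      exact exitRank_lt_of_notMem (hB0 k) hu'

/-! ### Positional strategies that follow the ranks -/

variable {G} in
theorem play_succ (v : V) (α : G.Strategy₁) (β : G.Strategy₂) (k : ℕ) :
    ∃ h, play v α β (k + 1) = next α β h (play v α β k) :=
  ⟨_, rfl⟩

theorem parityFix_subset_winningSet₂ [Finite V] :
    G.parityFix p ⊆ G.winningSet₂ (ParityObjective p) := by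
  classical
  intro v hv
  obtain ⟨r, hr⟩ := G.exists_rank_of_mem_parityFix p
  have hβ : ∀ x : G.V₂, ∃ u : {u // G.E x u}, x.1 ∈ G.parityFix p →
      u.1 ∈ G.parityFix p ∧ (p x = 1 → r u < r x) ∧ (p x = 2 → r u ≤ r x) := fun x => by
    by_cases hx : x.1 ∈ G.parityFix p
    · obtain ⟨u, hu, h⟩ := (hr x hx).2 x.2
      exact ⟨⟨u, hu⟩, fun _ => h⟩
    · obtain ⟨u, hu⟩ := G.exists_succ x
      exact ⟨⟨u, hu⟩, fun h => absurd h hx⟩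
  choose β hβ using hβ
  refine ⟨fun _ => β, fun α => ?_⟩
  set ω := play v α (fun _ => β) with hω
  have hnext : ∀ k, ω k ∈ G.parityFix p → ω (k + 1) ∈ G.parityFix p ∧
      (p (ω k) = 1 → r (ω (k + 1)) < r (ω k)) ∧ (p (ω k) = 2 → r (ω (k + 1)) ≤ r (ω k)) :=
    fun k hk => by
      obtain ⟨h, e⟩ := play_succ v α (fun _ => β) k
      rw [← hω] at e
      rw [e]
      unfold next
      split_ifs with h₁
      · exact (hr _ hk).1 h₁ _ (α h ⟨_, h₁⟩).2
      · exact hβ ⟨_, h₁⟩ hk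
  have hmem : ∀ k, ω k ∈ G.parityFix p := fun k => by
    induction k with
    | zero => exact hv
    | succ k ih => exact (hnext k ih).1
  rw [mem_parityObjective_iff]
  exact frequently_zero_or_eventually_ne_one (r := fun k => r (ω k))
    (fun k => (hnext k (hmem k)).2.1) (fun k => (hnext k (hmem k)).2.2)

theorem winningSet₂_subset_parityFix [Finite V] :
    G.winningSet₂ (ParityObjective p) ⊆ G.parityFix p := by
  classical
  rintro v ⟨β, hβ⟩
  by_contra hv
  obtain ⟨n, m, hr⟩ := G.exists_rank_of_notMem_parityFix p
  simp only [notMem_cpre_iff, Set.mem_ofPred_eq, not_not] at hr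
  have hα : ∀ x : G.V₁, ∃ u : {u // G.E x u}, x.1 ∉ G.parityFix p →
      u.1 ∉ G.parityFix p ∧ n u ≤ n x ∧ (p x = 0 → n u < n x) ∧
        (p x = 2 → n u < n x ∨ m u < m x) := fun x => by
    by_cases hx : x.1 ∉ G.parityFix p
    · obtain ⟨u, hu, h⟩ := (hr x hx).1 x.2
      exact ⟨⟨u, hu⟩, fun _ => h⟩
    · obtain ⟨u, hu⟩ := G.exists_succ x
      exact ⟨⟨u, hu⟩, fun h => absurd h hx⟩
  choose α hα using hα
  have hwin := hβ fun _ => α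
  set ω := play v (fun _ => α) β with hω
  have hnext : ∀ k, ω k ∉ G.parityFix p → ω (k + 1) ∉ G.parityFix p ∧
      n (ω (k + 1)) ≤ n (ω k) ∧ (p (ω k) = 0 → n (ω (k + 1)) < n (ω k)) ∧
      (p (ω k) = 2 → n (ω (k + 1)) < n (ω k) ∨ m (ω (k + 1)) < m (ω k)) :=
    fun k hk => by
      obtain ⟨h, e⟩ := play_succ v (fun _ => α) β k
      rw [← hω] at e
      rw [e]
      unfold next
      split_ifs with h₁
      · exact hα ⟨_, h₁⟩ hk
      · exact (hr _ hk).2 h₁ _ (β h ⟨_, h₁⟩).2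
  have hmem : ∀ k, ω k ∉ G.parityFix p := fun k => by
    induction k with
    | zero => exact hv
    | succ k ih => exact (hnext k ih).1
  rw [mem_parityObjective_iff] at hwin
  have := eventually_ne_zero_and_frequently_one (q := fun k => p (ω k))
    (n := fun k => n (ω k)) (m := fun k => m (ω k)) (fun k => (hnext k (hmem k)).2.1)
    (fun k => (hnext k (hmem k)).2.2.1) (fun k => (hnext k (hmem k)).2.2.2)
  rcases hwin with h | h
  · exact h this.1
  · exact this.2 (h.mono fun _ h => h)

theorem winningSet₂_eq_parityFix [Finite V] :
    G.winningSet₂ (ParityObjective p) = G.parityFix p :=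
  (G.winningSet₂_subset_parityFix p).antisymm (G.parityFix_subset_winningSet₂ p)

end GameGraph


/-! ### The simulation game, one round at a time -/

section Simulation

variable {Obs W W' A₁ A₂ A₁' A₂' : Type*}
variable (K : FairATS Obs W A₁ A₂) (K' : FairATS Obs W' A₁' A₂')

/-- A finite sum covers all vertices; the `Option` absorbs state pairs with different labels. -/
instance [Finite W] [Finite W'] : Finite (SimVertex K K') := by
  let f : (W × W') ⊕ (K.SuccSets × K'.SuccSets) ⊕ Unit ⊕ (K.SuccSets × W') ⊕
      (K.SuccSets × W') → Option (SimVertex K K') := fun x => by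
    classical
    exact match x with
    | .inl s => if h : K.L s.1 = K'.L s.2 then some (.pair s.1 s.2 h) else none
    | .inr (.inl s) => some (.succPair s.1 s.2)
    | .inr (.inr (.inl _)) => some .frown
    | .inr (.inr (.inr (.inl s))) => some (.hash s.1 s.2)
    | .inr (.inr (.inr (.inr s))) => some (.dollar s.1 s.2)
  have hf : ∀ v : SimVertex K K', ∃ x, f x = some v := by
    rintro (⟨w, w', h⟩ | ⟨T, T'⟩ | _ | ⟨T, w'⟩ | ⟨T, w'⟩)
    · exact ⟨.inl (w, w'), dif_pos h⟩
    · exact ⟨.inr (.inl (T, T')), rfl⟩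
    · exact ⟨.inr (.inr (.inl ())), rfl⟩
    · exact ⟨.inr (.inr (.inr (.inl (T, w')))), rfl⟩
    · exact ⟨.inr (.inr (.inr (.inr (T, w')))), rfl⟩
  choose g hg using hf
  exact Finite.of_injective g fun v v' h => by
    have := (hg v).symm.trans ((congrArg f h).trans (hg v'))
    exact Option.some_injective _ this

open Classical in
/-- The priority of a state pair. -/
noncomputable def pairPriority (s : W × W') : Fin 3 :=
  if s.2 ∈ K'.F then 0 else if s.1 ∈ K.F then 1 else 2

theorem pairPriority_eq_zero_iff {s : W × W'} : pairPriority K K' s = 0 ↔ s.2 ∈ K'.F := by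
  unfold pairPriority
  split_ifs <;> simp_all

theorem mem_of_pairPriority_eq_one {s : W × W'} (h : pairPriority K K' s = 1) :
    s.1 ∈ K.F := by
  unfold pairPriority at h
  split_ifs at h <;> simp_all

theorem pairPriority_eq_one {s : W × W'} (h : s.1 ∈ K.F) (h' : s.2 ∉ K'.F) :
    pairPriority K K' s = 1 := by
  simp [pairPriority, h, h']

variable {K K'} in
theorem mem_simWin₂_iff [Finite W] [Finite W'] {s : W × W'} :
    s ∈ simWin₂ K K' ↔ ∃ h : K.L s.1 = K'.L s.2,
      SimVertex.pair s.1 s.2 h ∈ (simGame K K').parityFix (simPriority K K') := by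
  rw [← GameGraph.winningSet₂_eq_parityFix]
  rfl

open Classical in
/-- A function on the vertices of the game as a function on state pairs. -/
noncomputable def onPairs (r : SimVertex K K' → ℕ) (s : W × W') : ℕ :=
  if h : K.L s.1 = K'.L s.2 then r (.pair s.1 s.2 h) else 0

variable {K K'} in
theorem onPairs_eq (r : SimVertex K K' → ℕ) {s : W × W'} (h : K.L s.1 = K'.L s.2) :
    onPairs K K' r s = r (.pair s.1 s.2 h) :=
  dif_pos h

variable {K K'} in
theorem onPairs_mk (r : SimVertex K K' → ℕ) {w : W} {w' : W'} (h : K.L w = K'.L w') :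
    onPairs K K' r (w, w') = r (.pair w w' h) :=
  dif_pos h

/-- On the winning set of player 2 there is a rank that player 2 can keep from increasing in
each round, and that decreases at the pairs of priority 1, unless a pair of priority 0 is
visited. -/
theorem exists_rank_of_mem_simWin₂ [Finite W] [Finite W'] :
    ∃ r : W × W' → ℕ, ∀ s ∈ simWin₂ K K', ∀ a ∈ K.P₁ s.1, ∃ a' ∈ K'.P₁ s.2,
      ∀ b' ∈ K'.P₂ s.2, ∃ b ∈ K.P₂ s.1,
        (K.δ s.1 a b, K'.δ s.2 a' b') ∈ simWin₂ K K' ∧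
        (pairPriority K K' s = 1 → r (K.δ s.1 a b, K'.δ s.2 a' b') < r s) ∧
        (pairPriority K K' s = 2 → r (K.δ s.1 a b, K'.δ s.2 a' b') ≤ r s) := by
  obtain ⟨r, hr⟩ := (simGame K K').exists_rank_of_mem_parityFix (simPriority K K')
  refine ⟨onPairs K K' r, fun s hs a ha => ?_⟩
  obtain ⟨h, hs⟩ := mem_simWin₂_iff.1 hs
  obtain ⟨hm₁, h₁, h₁'⟩ := (hr _ hs).1 trivial _ (.e₁ _ _ h a ha)
  obtain ⟨v₂, he₂, hm₂, -, h₂⟩ := (hr _ hm₁).2 (fun h => h)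
  cases he₂ with
  | e₂ _ _ a' ha' =>
  refine ⟨a', ha', fun b' hb' => ?_⟩
  obtain ⟨hm₃, -, h₃⟩ := (hr _ hm₂).1 trivial _ (.e₃ _ _ _ ⟨b', hb', rfl⟩)
  obtain ⟨v₄, he₄, hm₄, -, h₄⟩ := (hr _ hm₃).2 (fun h => h)
  -- The last three vertices of the round have priority 2, so the rank does not rise after the first
  -- edge.
  have h₂ := h₂ rfl
  have h₃ := h₃ rfl
  have h₄ := h₄ rfl
  cases he₄ with
  | e₄₁ _ r _ hr h' =>
    obtain ⟨b, hb, rfl⟩ := hr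
    refine ⟨b, hb, mem_simWin₂_iff.2 ⟨h', hm₄⟩, fun hp => ?_, fun hp => ?_⟩
    · rw [onPairs_eq r h, onPairs_mk r h']
      have := h₁ hp
      omega
    · rw [onPairs_eq r h, onPairs_mk r h']
      have := h₁' hp
      omega
  | e₄₂ _ _ _ =>
    -- A winning sink would have rank below itself, by its loop and priority 1.
    have := ((hr _ hm₄).1 trivial _ .e₅).2.1 rfl
    exact absurd this (lt_irrefl _)

/-- Off the winning set of player 2 there are ranks `n` and `m` such that player 1 can force
`n` not to increase, `n` to decrease at the pairs of priority 0, and one of `n` and `m` to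
decrease at the pairs of priority 2, as long as the labels of the pairs agree. -/
theorem exists_rank_of_notMem_simWin₂ [Finite W] [Finite W'] :
    ∃ n m : W × W' → ℕ, ∀ s ∉ simWin₂ K K', K.L s.1 = K'.L s.2 → ∃ a ∈ K.P₁ s.1,
      ∀ a' ∈ K'.P₁ s.2, ∃ b' ∈ K'.P₂ s.2, ∀ b ∈ K.P₂ s.1,
        K.L (K.δ s.1 a b) = K'.L (K'.δ s.2 a' b') →
        (K.δ s.1 a b, K'.δ s.2 a' b') ∉ simWin₂ K K' ∧
        n (K.δ s.1 a b, K'.δ s.2 a' b') ≤ n s ∧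
        (pairPriority K K' s = 0 → n (K.δ s.1 a b, K'.δ s.2 a' b') < n s) ∧
        (pairPriority K K' s = 2 → n (K.δ s.1 a b, K'.δ s.2 a' b') < n s ∨
          m (K.δ s.1 a b, K'.δ s.2 a' b') < m s) := by
  obtain ⟨n, m, hr⟩ := (simGame K K').exists_rank_of_notMem_parityFix (simPriority K K')
  simp only [GameGraph.notMem_cpre_iff, Set.mem_ofPred_eq, not_not] at hr
  refine ⟨onPairs K K' n, onPairs K K' m, fun s hs h => ?_⟩
  have hs : SimVertex.pair s.1 s.2 h ∉ (simGame K K').parityFix (simPriority K K') :=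
    fun hm => hs (mem_simWin₂_iff.2 ⟨h, hm⟩)
  obtain ⟨v₁, he₁, hm₁, h₁, h₁₀, h₁₂⟩ := (hr _ hs).1 trivial
  cases he₁ with
  | e₁ _ _ _ a ha =>
  refine ⟨a, ha, fun a' ha' => ?_⟩
  obtain ⟨hm₂, h₂, -, h₂₂⟩ := (hr _ hm₁).2 (fun h => h) _ (.e₂ _ _ a' ha')
  obtain ⟨v₃, he₃, hm₃, h₃, -, h₃₂⟩ := (hr _ hm₂).1 trivial
  cases he₃ with
  | e₃ _ _ r' hr' =>
  obtain ⟨b', hb', rfl⟩ := hr'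
  refine ⟨b', hb', fun b hb h' => ?_⟩
  obtain ⟨hm₄, h₄, -, h₄₂⟩ := (hr _ hm₃).2 (fun h => h) _ 
    (.e₄₁ _ (K.δ s.1 a b) _ (show _ ∈ K.Succ s.1 a from ⟨b, hb, rfl⟩) h')
  -- At these three vertices `n` or `m` drops. With `n` never rising, either it drops in the round
  -- or `m` drops at each priority 2 vertex.
  have h₂₂ := h₂₂ rfl
  have h₃₂ := h₃₂ rfl
  have h₄₂ := h₄₂ rfl
  rw [onPairs_eq n h, onPairs_eq m h, onPairs_mk n h', onPairs_mk m h']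
  refine ⟨fun hm => ?_, by omega, fun hp => ?_, fun hp => ?_⟩
  · obtain ⟨_, hm⟩ := mem_simWin₂_iff.1 hm
    exact hm₄ hm
  · have := h₁₀ hp
    omega
  · have := h₁₂ hp
    omega

/-! ### From ranks to simulations -/

variable {K K'}

section Runs

variable (w : W) (w' : W') (τ : Tau (W' := W') K) (τ' : Tau' (W := W) (A₁ := A₁) K')
  (ξ : Xi (W' := W') (A₁' := A₁') (A₂' := A₂') K) (ξ' : Xi' (W := W) (A₁ := A₁) K')

theorem simAux_fst (n : ℕ) :
    (simAux w w' τ τ' ξ ξ' n).1 =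
      (List.range n).map fun k => (simAux w w' τ τ' ξ ξ' k).2 := by
  induction n with
  | zero => rfl
  | succ n ih => rw [simAux, List.range_succ, List.map_append, ← ih]; rfl

theorem isRun_simRun : K.IsRun w (simRun w w' τ τ' ξ ξ') :=
  ⟨rfl, fun _ => ⟨_, (τ _ _).2, _, (ξ _ _ _ _ _).2, rfl⟩⟩

theorem isRun_simRun' : K'.IsRun w' (simRun' w w' τ τ' ξ ξ') :=
  ⟨rfl, fun _ => ⟨_, (τ' _ _ _).2, _, (ξ' _ _ _ _).2, rfl⟩⟩

end Runs

theorem IsStrongFairAltSim.isWeakFairAltSim {S : Set (W × W')} (h : IsStrongFairAltSim K K' S) :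
    IsWeakFairAltSim K K' S := fun w w' => by
  obtain ⟨h₁, τ', ξ, h₂⟩ := h w w'
  exact ⟨h₁, τ', fun τ => ⟨ξ, h₂ τ⟩⟩

variable (K K')

theorem isStrongFairAltSim_simWin₂ [Finite W] [Finite W'] :
    IsStrongFairAltSim K K' (simWin₂ K K') := by
  classical
  obtain ⟨r, hr⟩ := exists_rank_of_mem_simWin₂ K K'
  have hτ : ∀ (s : W × W') (a : A₁), ∃ a' : {a' // a' ∈ K'.P₁ s.2},
      s ∈ simWin₂ K K' → a ∈ K.P₁ s.1 → ∀ b' ∈ K'.P₂ s.2, ∃ b ∈ K.P₂ s.1,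
        (K.δ s.1 a b, K'.δ s.2 a' b') ∈ simWin₂ K K' ∧
        (pairPriority K K' s = 1 → r (K.δ s.1 a b, K'.δ s.2 a' b') < r s) ∧
        (pairPriority K K' s = 2 → r (K.δ s.1 a b, K'.δ s.2 a' b') ≤ r s) := fun s a => by
    by_cases h : s ∈ simWin₂ K K' ∧ a ∈ K.P₁ s.1
    · obtain ⟨a', ha', h'⟩ := hr s h.1 a h.2
      exact ⟨⟨a', ha'⟩, fun _ _ => h'⟩
    · obtain ⟨a', ha'⟩ := K'.P₁_nonempty s.2
      exact ⟨⟨a', ha'⟩, fun h₁ h₂ => absurd ⟨h₁, h₂⟩ h⟩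
  choose τ' hτ' using hτ
  have hξ : ∀ (s : W × W') (a : A₁) (a' : A₁') (b' : A₂'), ∃ b : {b // b ∈ K.P₂ s.1},
      s ∈ simWin₂ K K' → a ∈ K.P₁ s.1 → a' = τ' s a → b' ∈ K'.P₂ s.2 →
        (K.δ s.1 a b, K'.δ s.2 a' b') ∈ simWin₂ K K' ∧
        (pairPriority K K' s = 1 → r (K.δ s.1 a b, K'.δ s.2 a' b') < r s) ∧
        (pairPriority K K' s = 2 → r (K.δ s.1 a b, K'.δ s.2 a' b') ≤ r s) :=
    fun s a a' b' => by
      by_cases h : s ∈ simWin₂ K K' ∧ a ∈ K.P₁ s.1 ∧ a' = τ' s a ∧ b' ∈ K'.P₂ s.2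
      · obtain ⟨hs, ha, rfl, hb'⟩ := h
        obtain ⟨b, hb, h'⟩ := hτ' s a hs ha b' hb'
        exact ⟨⟨b, hb⟩, fun _ _ _ _ => h'⟩
      · obtain ⟨b, hb⟩ := K.P₂_nonempty s.1
        exact ⟨⟨b, hb⟩, fun h₁ h₂ h₃ h₄ => absurd ⟨h₁, h₂, h₃, h₄⟩ h⟩
  choose ξ hξ using hξ
  refine fun w w' => ⟨fun h => h.1, fun _ => τ', fun _ => ξ, fun τ ξ' hs hfair => ?_⟩
  set σ := fun n => (simAux w w' τ (fun _ => τ') (fun _ => ξ) ξ' n).2 with hσ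
  have hnext : ∀ n, σ n ∈ simWin₂ K K' → σ (n + 1) ∈ simWin₂ K K' ∧
      (pairPriority K K' (σ n) = 1 → r (σ (n + 1)) < r (σ n)) ∧
      (pairPriority K K' (σ n) = 2 → r (σ (n + 1)) ≤ r (σ n)) := fun n hn =>
    hξ (σ n) _ _ _ hn (τ _ _).2 rfl (ξ' _ _ _ _).2
  have hmem : ∀ n, σ n ∈ simWin₂ K K' := fun n => by
    induction n with
    | zero => exact hs
    | succ n ih => exact (hnext n ih).1
  refine ⟨⟨isRun_simRun' .., ?_⟩, hmem⟩
  have hf := (infOften_inter_nonempty_iff _ _).1 hfair.2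
  rw [infOften_inter_nonempty_iff]
  have h0 := frequently_zero_or_eventually_ne_one (q := fun k => pairPriority K K' (σ k))
    (r := fun k => r (σ k)) (fun k => (hnext k (hmem k)).2.1) (fun k => (hnext k (hmem k)).2.2)
  simp only [pairPriority_eq_zero_iff] at h0
  rcases h0 with h | h
  · exact h
  -- A pair whose first state is in `F` and whose priority is not 1 has its second state in `F'`.
  · exact (hf.and_eventually h).mono fun k hk => by
      by_contra h'
      exact hk.2 (pairPriority_eq_one K K' hk.1 h')

variable {K K'}

/-- Agent 1 can follow `α` while the condition `D` holds on the state pairs, and still ensure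
fairness if `D` is ever violated. -/
theorem exists_tau_isFairRun [Finite W] (hK : ∀ w : W, K.CanEnsureFairness w)
    (D : W × W' → Prop) (α : ∀ s : W × W', {a // a ∈ K.P₁ s.1}) :
    ∃ τ : Tau (W' := W') K,
      (∀ h s, (∀ t ∈ h, D t) → D s → τ h s = α s) ∧
      ∀ w w' (τ' : Tau' (W := W) (A₁ := A₁) K')
        (ξ : Xi (W' := W') (A₁' := A₁') (A₂' := A₂') K) (ξ' : Xi' (W := W) (A₁ := A₁) K'),
        (∃ n, ¬ D (simAux w w' τ τ' ξ ξ' n).2) →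
          K.IsFairRun w (simRun w w' τ τ' ξ ξ') := by
  classical
  choose σ hσ using hK
  -- `dropWhile` finds the first violation of `D`; the fairness strategy is started afresh there,
  -- and fairness depends only on the tail.
  let τ : Tau (W' := W') K := fun h s =>
    match h.dropWhile (fun t => decide (D t)) with
    | [] => if D s then α s else σ s.1 [] s.1
    | t :: l => σ t.1 ((t :: l).map Prod.fst) s.1
  refine ⟨τ, fun h s hh hs => ?_, fun w w' τ' ξ ξ' hex => ?_⟩
  · have : h.dropWhile (fun t => decide (D t)) = [] := by simpa using hh
    simp only [τ, this, if_pos hs]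
  · set π := fun n => (simAux w w' τ τ' ξ ξ' n).2 with hπ
    set N := Nat.find hex with hN
    have hbad : ¬ D (π N) := Nat.find_spec hex
    have hgood : ∀ k < N, D (π k) := fun k hk => not_not.1 (Nat.find_min hex hk)
    have hdrop : ∀ k, ((List.range (N + k)).map π).dropWhile (fun t => decide (D t)) =
        (List.range k).map fun j => π (N + j) := fun k => by
      rw [List.range_add, List.map_append, List.dropWhile_append_of_pos]
      · cases k with
        | zero => rfl
        | succ k =>
          rw [List.range_succ_eq_map]
          simp [hbad, Function.comp_def]
      · simpa using hgood
    have hτ : ∀ k, τ (simAux w w' τ τ' ξ ξ' (N + k)).1 (π (N + k)) =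
        σ (π N).1 ((List.range k).map fun j => (π (N + j)).1) (π (N + k)).1 := fun k => by
      rw [simAux_fst]
      simp only [τ]
      rw [hdrop]
      cases k with
      | zero => simp [hbad]
      | succ k =>
        rw [List.range_succ_eq_map]
        simp [Function.comp_def]
    have hfair := hσ (π N).1 (fun k => (π (N + k)).1) rfl fun k =>
      ⟨_, (ξ _ _ _ _ _).2, by rw [← hτ]; rfl⟩
    refine ⟨isRun_simRun .., ?_⟩
    have h := (infOften_inter_nonempty_iff _ _).1 hfair.2
    rw [infOften_inter_nonempty_iff, Filter.frequently_atTop]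
    intro M
    obtain ⟨k, hk, hF⟩ := Filter.frequently_atTop.1 h M
    exact ⟨N + k, by omega, hF⟩

theorem IsWeakFairAltSim.subset_simWin₂ [Finite W] [Finite W']
    (hK : ∀ w : W, K.CanEnsureFairness w) {S : Set (W × W')} (hS : IsWeakFairAltSim K K' S) :
    S ⊆ simWin₂ K K' := by
  classical
  rintro ⟨w, w'⟩ hwS
  by_contra hw
  obtain ⟨n, m, hr⟩ := exists_rank_of_notMem_simWin₂ K K'
  let D : W × W' → Prop := fun s => K.L s.1 = K'.L s.2
  let Good : W × W' → W × W' → Prop := fun s t => D t → t ∉ simWin₂ K K' ∧ n t ≤ n s ∧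
    (pairPriority K K' s = 0 → n t < n s) ∧ (pairPriority K K' s = 2 → n t < n s ∨ m t < m s)
  have hα : ∀ s : W × W', ∃ a : {a // a ∈ K.P₁ s.1}, s ∉ simWin₂ K K' → D s →
      ∀ a' ∈ K'.P₁ s.2, ∃ b' ∈ K'.P₂ s.2, ∀ b ∈ K.P₂ s.1,
        Good s (K.δ s.1 a b, K'.δ s.2 a' b') := fun s => by
    by_cases h : s ∉ simWin₂ K K' ∧ D s
    · obtain ⟨a, ha, h'⟩ := hr s h.1 h.2
      exact ⟨⟨a, ha⟩, fun _ _ => h'⟩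
    · obtain ⟨a, ha⟩ := K.P₁_nonempty s.1
      exact ⟨⟨a, ha⟩, fun h₁ h₂ => absurd ⟨h₁, h₂⟩ h⟩
  choose α hα using hα
  have hξ : ∀ (s : W × W') (a : A₁) (a' : A₁'), ∃ b' : {b' // b' ∈ K'.P₂ s.2},
      s ∉ simWin₂ K K' → D s → a = α s → a' ∈ K'.P₁ s.2 → ∀ b ∈ K.P₂ s.1,
        Good s (K.δ s.1 a b, K'.δ s.2 a' b') := fun s a a' => by
    by_cases h : s ∉ simWin₂ K K' ∧ D s ∧ a = α s ∧ a' ∈ K'.P₁ s.2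
    · obtain ⟨hs, hD, rfl, ha'⟩ := h
      obtain ⟨b', hb', h'⟩ := hα s hs hD a' ha'
      exact ⟨⟨b', hb'⟩, fun _ _ _ _ => h'⟩
    · obtain ⟨b', hb'⟩ := K'.P₂_nonempty s.2
      exact ⟨⟨b', hb'⟩, fun h₁ h₂ h₃ h₄ => absurd ⟨h₁, h₂, h₃, h₄⟩ h⟩
  choose ξ' hξ' using hξ
  obtain ⟨τ, hτα, hτ⟩ := exists_tau_isFairRun (K' := K') hK D α
  obtain ⟨-, τ', hsim⟩ := hS w w'
  obtain ⟨ξ, hsim⟩ := hsim τ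
  have hsim := hsim (fun _ => ξ') hwS
  set σ := fun k => (simAux w w' τ τ' ξ (fun _ => ξ') k).2 with hσ
  -- A mismatch would make ρ fair through τ, and then matching forces equal labels.
  have hD : ∀ k, D (σ k) := by
    by_contra! hex
    obtain ⟨-, hm⟩ := hsim (hτ w w' τ' ξ (fun _ => ξ') hex)
    obtain ⟨k, hk⟩ := hex
    exact hk ((hS _ _).1 (hm k))
  have hact : ∀ k, τ (simAux w w' τ τ' ξ (fun _ => ξ') k).1 (σ k) = α (σ k) := fun k => by
    refine hτα _ _ (fun t ht => ?_) (hD k)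
    rw [simAux_fst w w' τ τ' ξ fun _ => ξ'] at ht
    obtain ⟨j, -, rfl⟩ := List.mem_map.1 ht
    exact hD j
  have hnext : ∀ k, σ k ∉ simWin₂ K K' → Good (σ k) (σ (k + 1)) := fun k hk =>
    hξ' (σ k) _ _ hk (hD k) (congrArg Subtype.val (hact k)) (τ' _ _ _).2 _ (ξ _ _ _ _ _).2
  have hmem : ∀ k, σ k ∉ simWin₂ K K' := fun k => by
    induction k with
    | zero => exact hw
    | succ k ih => exact (hnext k ih (hD _)).1
  have hgood := fun k => hnext k (hmem k) (hD _)
  obtain ⟨h0, h1⟩ := eventually_ne_zero_and_frequently_one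
    (q := fun k => pairPriority K K' (σ k)) (n := fun k => n (σ k)) (m := fun k => m (σ k))
    (fun k => (hgood k).2.1) (fun k => (hgood k).2.2.1) (fun k => (hgood k).2.2.2)
  -- With labels always equal, fairness comes from the recurring priority 1 alone.
  have hfair : K.IsFairRun w (simRun w w' τ τ' ξ fun _ => ξ') :=
    ⟨isRun_simRun .., (infOften_inter_nonempty_iff _ _).2
      (h1.mono fun _ => mem_of_pairPriority_eq_one K K')⟩
  have hF' := (infOften_inter_nonempty_iff _ _).1 (hsim hfair).1.2
  exact hF' (h0.mono fun k hk h' => hk ((pairPriority_eq_zero_iff K K').2 h'))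

end Simulation

theorem mainTheorem4 {Obs W W' A₁ A₂ A₁' A₂' : Type*}
    [Finite Obs] [Finite W] [Finite W'] [Finite A₁] [Finite A₂] [Finite A₁'] [Finite A₂']
    (K : FairATS Obs W A₁ A₂) (K' : FairATS Obs W' A₁' A₂')
    (hK : ∀ w : W, K.CanEnsureFairness w) :
    IsGreatest {S : Set (W × W') | IsWeakFairAltSim K K' S} (simWin₂ K K') ∧
    IsGreatest {S : Set (W × W') | IsStrongFairAltSim K K' S} (simWin₂ K K') := by
  have hstrong := isStrongFairAltSim_simWin₂ K K'
  exact ⟨⟨hstrong.isWeakFairAltSim, fun S hS => IsWeakFairAltSim.subset_simWin₂ hK hS⟩,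
    ⟨hstrong, fun S hS => IsWeakFairAltSim.subset_simWin₂ hK hS.isWeakFairAltSim⟩⟩
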